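/- Let $m>1$ be an integer and let $d=2m$. Define a sequence of random graphs $(G_n)_{n\ge m+1}$ as follows. $G_{m+1}$ is the complete graph on $m+1$ vertices. Given $G_n$, the graph $G_{n+1}$ is obtained by adding one new vertex and joining it to $m$ distinct vertices of $G_n$, the $m$-element set of these vertices being chosen uniformly at random among all $m$-element sets of vertices that have degree less than $d$ in $G_n$ (there are always at least $m$ such vertices). Then $(G_n)$ obeys the first-order convergence law: for every first-order sentence $\varphi$ in the language of graphs (whose only relation symbols are adjacency and equality of vertices), the probability $\Pr(G_n\models\varphi)$ converges as $n\to\infty$. -/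

import Mathlib

open FirstOrder

namespace UniformAttachment

/-- The graph on `n + 1` vertices obtained from a graph `G` on `n` vertices by adding a new
vertex, `Fin.last n`, and joining it to exactly the vertices in `S`. -/
def addVertex {n : ℕ} (G : SimpleGraph (Fin n)) (S : Finset (Fin n)) :
    SimpleGraph (Fin (n + 1)) :=
  G.map Fin.castSucc ⊔
    SimpleGraph.fromRel (fun u v => u = Fin.last n ∧ ∃ s ∈ S, v = Fin.castSucc s)

open Classical in
/-- The vertices of `G` whose degree is less than `d`. -/
noncomputable def openVertices {n : ℕ} (d : ℕ) (G : SimpleGraph (Fin n)) : Finset (Fin n) :=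
  Finset.univ.filter (fun v => G.degree v < d)

open Classical in
/-- One step of the attachment process: a set `S` of `m` distinct vertices is chosen uniformly
among all `m`-element sets of vertices of degree less than `d`, and a new vertex is joined to the
vertices in `S`. The second branch (fewer than `m` such vertices) is only there to make the function
total; `le_card_openVertices` shows that it is never used by the process with `d = 2 * m`. -/
noncomputable def step (m d : ℕ) {n : ℕ} (G : SimpleGraph (Fin n)) :
    PMF (SimpleGraph (Fin (n + 1))) :=
  if h : ((openVertices d G).powersetCard m).Nonempty then
    (PMF.uniformOfFinset ((openVertices d G).powersetCard m) h).map (addVertex G)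
  else
    PMF.pure (addVertex G ∅)

/-- The law of the random graph `G_{m+1+t}`, obtained from the complete graph on `m + 1` vertices
by `t` steps of the attachment process. Vertices are labelled by their order of appearance. -/
noncomputable def law (m d : ℕ) : (t : ℕ) → PMF (SimpleGraph (Fin (m + 1 + t)))
  | 0 => PMF.pure ⊤
  | t + 1 => (law m d t).bind (fun G => step m d G)

/-- `G ⊨ φ` for a first-order sentence `φ` in the language of graphs (adjacency and equality). -/
def Models {V : Type*} (G : SimpleGraph V) (φ : Language.graph.Sentence) : Prop :=
  @Language.Sentence.Realize Language.graph V G.structure φ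

/-- The probability that a random graph with law `μ` satisfies `φ`. -/
noncomputable def prob {V : Type*} (μ : PMF (SimpleGraph V)) (φ : Language.graph.Sentence) : ℝ :=
  (μ.toOuterMeasure {G | Models G φ}).toReal

/-- A sequence of random graphs, given by their laws, obeys the first-order convergence law. -/
def FOConvergenceLaw {V : ℕ → Type*} (μ : (t : ℕ) → PMF (SimpleGraph (V t))) : Prop :=
  ∀ φ : Language.graph.Sentence,
    ∃ p : ℝ, Filter.Tendsto (fun t => prob (μ t) φ) Filter.atTop (nhds p)

/-! ### The process never runs out of vertices of degree less than `2 * m` -/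

theorem addVertex_adj_castSucc {n : ℕ} (G : SimpleGraph (Fin n)) (S : Finset (Fin n))
    (u v : Fin n) : (addVertex G S).Adj u.castSucc v.castSucc ↔ G.Adj u v := by
  rw [addVertex, SimpleGraph.sup_adj, SimpleGraph.map_adj']
  simp only [SimpleGraph.fromRel_adj]
  grind [Fin.castSucc_ne_last, Fin.castSucc_inj, SimpleGraph.Adj.ne]

theorem addVertex_adj_last {n : ℕ} (G : SimpleGraph (Fin n)) (S : Finset (Fin n))
    (u : Fin n) : (addVertex G S).Adj u.castSucc (Fin.last n) ↔ u ∈ S := by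
  rw [addVertex, SimpleGraph.sup_adj, SimpleGraph.map_adj']
  simp only [SimpleGraph.fromRel_adj]
  grind [Fin.castSucc_ne_last, Fin.castSucc_inj, SimpleGraph.Adj.ne]

open Classical in
theorem degree_eq_sum {n : ℕ} (G : SimpleGraph (Fin n)) (v : Fin n) :
    G.degree v = ∑ u, if G.Adj v u then 1 else 0 := by
  rw [← SimpleGraph.card_neighborFinset_eq_degree, SimpleGraph.neighborFinset_eq_filter,
    Finset.card_filter]

open Classical in
theorem degree_addVertex_castSucc {n : ℕ} (G : SimpleGraph (Fin n)) (S : Finset (Fin n))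
    (v : Fin n) :
    (addVertex G S).degree v.castSucc = G.degree v + if v ∈ S then 1 else 0 := by
  rw [degree_eq_sum, Fin.sum_univ_castSucc, degree_eq_sum]
  simp only [addVertex_adj_castSucc, addVertex_adj_last]

open Classical in
theorem degree_addVertex_last {n : ℕ} (G : SimpleGraph (Fin n)) (S : Finset (Fin n)) :
    (addVertex G S).degree (Fin.last n) = S.card := by
  rw [degree_eq_sum, Fin.sum_univ_castSucc]
  simp [SimpleGraph.adj_comm _ (Fin.last n), addVertex_adj_last]

open Classical in
theorem lt_card_openVertices {m n : ℕ} (hm : 0 < m) (G : SimpleGraph (Fin n))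
    (h1 : ∀ v, m ≤ G.degree v) (h2 : ∑ v, G.degree v + m * (m + 1) = 2 * m * n) :
    m < (openVertices (2 * m) G).card := by
  have h3 : ∑ _v : Fin n, 2 * m ≤
      ∑ v, (G.degree v + if G.degree v < 2 * m then m else 0) := by
    apply Finset.sum_le_sum
    intro v _
    have := h1 v
    split_ifs <;> omega
  rw [Finset.sum_add_distrib, ← Finset.sum_filter] at h3
  simp only [Finset.sum_const, smul_eq_mul, Finset.card_univ, Fintype.card_fin] at h3
  change _ ≤ _ + (openVertices (2 * m) G).card * m at h3
  have h4 : m * (m + 1) ≤ m * (openVertices (2 * m) G).card := by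
    nlinarith
  exact Nat.le_of_mul_le_mul_left h4 hm

open Classical in
theorem degrees_of_mem_support {m : ℕ} (hm : 0 < m) (t : ℕ) :
    ∀ G ∈ (law m (2 * m) t).support, (∀ v, m ≤ G.degree v) ∧
      ∑ v, G.degree v + m * (m + 1) = 2 * m * (m + 1 + t) := by
  induction t with
  | zero =>
    intro G hG
    simp only [law, PMF.support_pure, Set.mem_singleton_iff] at hG
    subst hG
    have hd : ∀ v : Fin (m + 1 + 0), (⊤ : SimpleGraph (Fin (m + 1 + 0))).degree v = m := by
      intro v
      rw [SimpleGraph.complete_graph_degree]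
      simp
    refine ⟨fun v => ?_, ?_⟩
    · refine le_of_eq ((hd v).symm.trans ?_)
      congr!
    · have e : ∑ v : Fin (m + 1 + 0), (⊤ : SimpleGraph (Fin (m + 1 + 0))).degree v
          = (m + 1) * m := by
        rw [Finset.sum_congr rfl (fun v _ => hd v)]
        simp
      convert congrArg (· + m * (m + 1)) e using 1
      · congr!
      · ring
  | succ t ih =>
    intro G hG
    simp only [law, PMF.mem_support_bind_iff] at hG
    obtain ⟨H, hH, hG⟩ := hG
    obtain ⟨h1, h2⟩ := ih H hH
    have hc := lt_card_openVertices hm H h1 h2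
    have hne : ((openVertices (2 * m) H).powersetCard m).Nonempty :=
      Finset.powersetCard_nonempty.2 hc.le
    rw [step, dif_pos hne, PMF.mem_support_map_iff] at hG
    obtain ⟨S, hS, rfl⟩ := hG
    rw [PMF.mem_support_uniformOfFinset_iff, Finset.mem_powersetCard] at hS
    constructor
    · intro v
      induction v using Fin.lastCases with
      | last => exact (hS.2 ▸ degree_addVertex_last H S).ge
      | cast v =>
        exact (h1 v).trans ((Nat.le_add_right _ _).trans (degree_addVertex_castSucc H S v).ge)
    · have e : ∑ v, (addVertex H S).degree v = ∑ v, H.degree v + m + m := by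
        rw [Fin.sum_univ_castSucc, degree_addVertex_last, hS.2]
        simp only [degree_addVertex_castSucc]
        rw [Finset.sum_add_distrib]
        simp [hS.2]
      calc _ = ∑ v, H.degree v + m + m + m * (m + 1) := congrArg (· + m * (m + 1)) e
        _ = _ := by linarith

/-- Every graph that the process can reach has at least `m` vertices of degree less than `2 * m`,
so a step always really joins the new vertex to `m` of them. -/
theorem le_card_openVertices {m : ℕ} (hm : 0 < m) (t : ℕ) (G : SimpleGraph (Fin (m + 1 + t)))
    (hG : G ∈ (law m (2 * m) t).support) : m ≤ (openVertices (2 * m) G).card :=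
  (lt_card_openVertices hm G (degrees_of_mem_support hm t G hG).1
    (degrees_of_mem_support hm t G hG).2).le

end UniformAttachment

/-! Every step adds `m` edges, so the total deficiency, the sum of `2 * m - deg v`, keeps the value
`m * (m + 1)`. The open vertices, repeated according to deficiency, thus form a list of constant
length. A step replaces `m` entries of this list, at distinct vertices, by the new vertex. All
neighbours of the new vertex are named by the old list, so the rank-`k` Ehrenfeucht–Fraïssé type of
the old list determines that of the new one, with no loss of rank (`efType_addVertex`). Up to the
order of the list, this type is a Markov chain on a finite set (`stepMean_eq_of_state_eq`), and for
suitable `k` it decides a given sentence.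

The transition operator is a contraction in the sup norm, so its powers converge as soon as `1` is
its only eigenvalue of modulus one (`exists_tendsto_pow_apply`). No irreducibility is needed: the
limit is taken from a fixed initial state.

To exclude other eigenvalues `μ`, let `|h|` be maximal at some state, for an eigenfunction `h`. By
strict convexity of the disc, every possible step from there multiplies `h` by `μ` and keeps `|h|`
maximal. Let the process build a strip, joining each new vertex to the last `m` vertices. Two long
strips of lengths `N` and `N + 1` are indistinguishable at rank `k` (`exists_state_strip_eq`), so
one step multiplies `h` by `μ` without changing it, and `μ = 1`. -/

namespace UniformAttachment

/-! ### Powers of a linear contraction -/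

section PowerBounded

open Filter Topology

theorem tendsto_zero_of_le_mul_add {c : ℝ} (hc0 : 0 ≤ c) (hc : c < 1) {r e : ℕ → ℝ}
    (hr : ∀ n, 0 ≤ r n) (he : Tendsto e atTop (𝓝 0)) (h : ∀ n, r (n + 1) ≤ c * r n + e n) :
    Tendsto r atTop (𝓝 0) := by
  rw [Metric.tendsto_atTop]
  intro ε hε
  -- With this bound on the error, `ε / 2` is the fixed point of the affine recursion.
  have hpos : 0 < ε / 2 * (1 - c) := mul_pos (by linarith) (by linarith)
  obtain ⟨N, hN⟩ := eventually_atTop.1 (he.eventually (gt_mem_nhds hpos))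
  have h1 : ∀ k, r (N + k) ≤ ε / 2 + c ^ k * r N := by
    intro k
    induction k with
    | zero => simp; linarith
    | succ k ih =>
      have h2 := h (N + k)
      have h3 := hN (N + k) (by omega)
      have h4 := mul_le_mul_of_nonneg_left ih hc0
      rw [← add_assoc, pow_succ]
      linarith
  have h5 : Tendsto (fun k => c ^ k * r N) atTop (𝓝 0) := by
    simpa using (tendsto_pow_atTop_nhds_zero_of_lt_one hc0 hc).mul_const (r N)
  obtain ⟨M, hM⟩ := eventually_atTop.1 (h5.eventually (gt_mem_nhds (half_pos hε)))
  refine ⟨N + M, fun n hn => ?_⟩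
  obtain ⟨k, rfl⟩ := Nat.exists_eq_add_of_le (show N ≤ n by omega)
  have h6 := h1 k
  have h7 := hM k (by omega)
  rw [Real.dist_eq, sub_zero, abs_of_nonneg (hr _)]
  linarith

variable {V : Type*} [NormedAddCommGroup V] [NormedSpace ℂ V]

theorem tendsto_pow_apply_zero (A : Module.End ℂ V) {μ : ℂ} (hμ : ‖μ‖ < 1) (k : ℕ) :
    ∀ v, ((A - algebraMap ℂ _ μ) ^ k) v = 0 → Tendsto (fun n => (A ^ n) v) atTop (𝓝 0) := by
  induction k with
  | zero =>
    intro v hv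
    have : v = 0 := by simpa using hv
    simp [this]
  | succ k ih =>
    intro v hv
    rw [pow_succ, Module.End.mul_apply] at hv
    have hw := ih _ hv
    rw [tendsto_zero_iff_norm_tendsto_zero]
    refine tendsto_zero_of_le_mul_add (norm_nonneg μ) hμ (fun _ => norm_nonneg _)
      (tendsto_zero_iff_norm_tendsto_zero.1 hw) fun n => ?_
    have : (A ^ (n + 1)) v = μ • (A ^ n) v + (A ^ n) ((A - algebraMap ℂ _ μ) v) := by
      rw [pow_succ, Module.End.mul_apply, LinearMap.sub_apply, map_sub,
        Module.algebraMap_end_apply, map_smul]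
      abel
    rw [this]
    refine (norm_add_le _ _).trans ?_
    rw [norm_smul]

theorem norm_pow_apply_le {A : Module.End ℂ V} (hA : ∀ v, ‖A v‖ ≤ ‖v‖) (n : ℕ) (v : V) :
    ‖(A ^ n) v‖ ≤ ‖v‖ := by
  induction n with
  | zero => simp
  | succ n ih =>
    rw [pow_succ', Module.End.mul_apply]
    exact (hA _).trans ih

/-- A nontrivial Jordan block at an eigenvalue of modulus one would make the orbit of `u` grow
linearly, which a contraction forbids. -/
theorem sub_apply_eq_zero_of_sq {A : Module.End ℂ V} (hA : ∀ v, ‖A v‖ ≤ ‖v‖) {μ : ℂ}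
    (hμ : ‖μ‖ = 1) {u : V}
    (hu : (A - algebraMap ℂ _ μ) ((A - algebraMap ℂ _ μ) u) = 0) :
    (A - algebraMap ℂ _ μ) u = 0 := by
  set w := (A - algebraMap ℂ _ μ) u with hw
  have hAu : A u = μ • u + w := by
    rw [hw, LinearMap.sub_apply, Module.algebraMap_end_apply]; abel
  have hAw : A w = μ • w := by
    rw [LinearMap.sub_apply, Module.algebraMap_end_apply] at hu
    exact sub_eq_zero.1 hu
  -- The extra factor `μ` avoids the exponent `n - 1`.
  have key : ∀ n : ℕ, μ • (A ^ n) u = (μ ^ (n + 1)) • u + ((n : ℂ) * μ ^ n) • w := by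
    intro n
    induction n with
    | zero => simp
    | succ n ih =>
      rw [pow_succ' A, Module.End.mul_apply, ← map_smul, ih, map_add, map_smul, map_smul, hAu, hAw,
        smul_add, smul_smul, smul_smul, add_assoc, ← add_smul]
      congr 2
      push_cast
      ring
  have bound : ∀ n : ℕ, (n : ℝ) * ‖w‖ ≤ 2 * ‖u‖ := by
    intro n
    have h1 : ((n : ℂ) * μ ^ n) • w = μ • (A ^ n) u - (μ ^ (n + 1)) • u := by
      rw [key n]; abel
    have h2 := norm_sub_le (μ • (A ^ n) u) ((μ ^ (n + 1)) • u)
    rw [← h1, norm_smul, norm_smul, norm_smul, norm_mul, norm_pow, norm_pow, hμ] at h2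
    simp only [Complex.norm_natCast, one_pow, one_mul, mul_one] at h2
    have := norm_pow_apply_le hA n u
    linarith
  by_contra hne
  have hpos : 0 < ‖w‖ := norm_pos_iff.2 hne
  obtain ⟨n, hn⟩ := exists_nat_gt (2 * ‖u‖ / ‖w‖)
  rw [div_lt_iff₀ hpos] at hn
  linarith [bound n]

theorem sub_apply_eq_zero_of_pow {A : Module.End ℂ V} (hA : ∀ v, ‖A v‖ ≤ ‖v‖) {μ : ℂ}
    (hμ : ‖μ‖ = 1) (k : ℕ) :
    ∀ v, ((A - algebraMap ℂ _ μ) ^ k) v = 0 → (A - algebraMap ℂ _ μ) v = 0 := by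
  induction k with
  | zero =>
    intro v hv
    have : v = 0 := by simpa using hv
    simp [this]
  | succ k ih =>
    intro v hv
    rw [pow_succ, Module.End.mul_apply] at hv
    exact sub_apply_eq_zero_of_sq hA hμ (ih _ hv)

/-- A contraction of a finite-dimensional space whose only eigenvalue of modulus one is `1` has
convergent powers. -/
theorem exists_tendsto_pow_apply [FiniteDimensional ℂ V] {A : Module.End ℂ V}
    (hA : ∀ v, ‖A v‖ ≤ ‖v‖)
    (hper : ∀ (μ : ℂ) (v : V), ‖μ‖ = 1 → v ≠ 0 → A v = μ • v → μ = 1) (v : V) :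
    ∃ l, Tendsto (fun n => (A ^ n) v) atTop (𝓝 l) := by
  have hv : v ∈ ⨆ μ : ℂ, A.maxGenEigenspace μ := by
    rw [Module.End.iSup_maxGenEigenspace_eq_top]; trivial
  induction hv using Submodule.iSup_induction' with
  | zero => exact ⟨0, by simp⟩
  | add x y _ _ hx hy =>
    obtain ⟨l, hl⟩ := hx
    obtain ⟨l', hl'⟩ := hy
    exact ⟨l + l', by simpa using hl.add hl'⟩
  | mem μ x hx =>
    obtain ⟨k, hk⟩ := (Module.End.mem_maxGenEigenspace A μ x).1 hx
    have hk : ((A - algebraMap ℂ _ μ) ^ k) x = 0 := hk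
    rcases lt_trichotomy ‖μ‖ 1 with hμ | hμ | hμ
    · exact ⟨0, tendsto_pow_apply_zero A hμ k x hk⟩
    · have h1 := sub_apply_eq_zero_of_pow hA hμ k x hk
      rw [LinearMap.sub_apply, Module.algebraMap_end_apply, sub_eq_zero] at h1
      refine ⟨x, ?_⟩
      have h2 : A x = x := by
        by_cases hx0 : x = 0
        · simp [hx0]
        · rw [h1, hper μ x hμ hx0 h1, one_smul]
      have h3 : ∀ n, (A ^ n) x = x := by
        intro n
        induction n with
        | zero => simp
        | succ n ih => rw [pow_succ, Module.End.mul_apply, h2, ih]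
      simp [h3]
    -- A contraction has no eigenvalue of modulus above one, so this generalized eigenspace is zero.
    · have hinj : ∀ y, (A - algebraMap ℂ _ μ) y = 0 → y = 0 := by
        intro y hy
        rw [LinearMap.sub_apply, Module.algebraMap_end_apply, sub_eq_zero] at hy
        have h1 := hA y
        rw [hy, norm_smul] at h1
        by_contra hne
        nlinarith [norm_pos_iff.2 hne]
      have h0 : ∀ (j : ℕ) (y : V), ((A - algebraMap ℂ _ μ) ^ j) y = 0 → y = 0 := by
        intro j
        induction j with
        | zero => intro y hy; simpa using hy
        | succ j ih =>
          intro y hy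
          rw [pow_succ, Module.End.mul_apply] at hy
          exact hinj y (ih _ hy)
      exact ⟨0, by simp [h0 k x hk]⟩

end PowerBounded

/-- If the average of complex numbers of modulus at most `‖z‖` is `z`, they are all equal to `z`. -/
theorem eq_of_sum_eq_card_mul {ι : Type*} (s : Finset ι) (w : ι → ℂ) (z : ℂ)
    (hw : ∀ i ∈ s, ‖w i‖ ≤ ‖z‖) (hs : ∑ i ∈ s, w i = s.card * z) : ∀ i ∈ s, w i = z := by
  -- Expanding the square gives a bound linear in `w i`; summed over `s`, it vanishes by the
  -- hypothesis on the average.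
  have h1 : ∀ i ∈ s, ‖w i - z‖ ^ 2 ≤ 2 * ‖z‖ ^ 2 - 2 * (w i * star z).re := by
    intro i hi
    have h2 := hw i hi
    have h3 : ‖w i - z‖ ^ 2 = ‖w i‖ ^ 2 + ‖z‖ ^ 2 - 2 * (w i * star z).re := by
      rw [Complex.sq_norm, Complex.sq_norm, Complex.sq_norm, Complex.normSq_sub]
      rfl
    have h4 : ‖w i‖ ^ 2 ≤ ‖z‖ ^ 2 := by gcongr
    linarith
  have h5 : ∑ i ∈ s, ‖w i - z‖ ^ 2 ≤ 0 := by
    refine (Finset.sum_le_sum h1).trans ?_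
    rw [Finset.sum_sub_distrib, ← Finset.mul_sum s (fun i => (w i * star z).re), ← Complex.re_sum,
      ← Finset.sum_mul s w, hs]
    have h6 : (s.card * z * star z).re = s.card * ‖z‖ ^ 2 := by
      rw [mul_assoc, Complex.star_def, Complex.mul_conj, ← Complex.sq_norm]
      norm_cast
    rw [h6]
    simp
    linarith
  intro i hi
  have h7 := (Finset.sum_eq_zero_iff_of_nonneg (fun i _ => sq_nonneg ‖w i - z‖)).1
    (le_antisymm h5 (Finset.sum_nonneg fun i _ => sq_nonneg _)) i hi
  exact sub_eq_zero.1 (norm_eq_zero.1 (pow_eq_zero_iff two_ne_zero |>.1 h7))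

/-! ### Ehrenfeucht–Fraïssé types and first-order formulas -/

/-- The type of rank-`k` Ehrenfeucht–Fraïssé types of `q`-tuples of vertices of a graph. -/
def EFType : ℕ → ℕ → Type
  | 0, q => Fin q → Fin q → Prop × Prop
  | k + 1, q => EFType k q × Set (EFType k (q + 1))

instance finite_efType (k : ℕ) : ∀ q, Finite (EFType k q) := by
  induction k with
  | zero => intro q; unfold EFType; infer_instance
  | succ k ih =>
    intro q
    have := ih q
    have := ih (q + 1)
    unfold EFType
    infer_instance

/-- The rank-`k` Ehrenfeucht–Fraïssé type of a tuple of vertices. -/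
def efType {V : Type*} (G : SimpleGraph V) : (k : ℕ) → {q : ℕ} → (Fin q → V) → EFType k q
  | 0, _, a => fun i j => (a i = a j, G.Adj (a i) (a j))
  | k + 1, q, a =>
    (efType G k a, Set.range fun x => efType G k (Fin.snoc a x : Fin (q + 1) → V))

section

variable {V W : Type*} {G : SimpleGraph V} {H : SimpleGraph W} {q : ℕ} {a : Fin q → V}
  {b : Fin q → W}

theorem efType_zero_eq_iff : efType G 0 a = efType H 0 b ↔
    ∀ i j, (a i = a j ↔ b i = b j) ∧ (G.Adj (a i) (a j) ↔ H.Adj (b i) (b j)) := by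
  constructor
  · intro h i j
    have h1 := congrFun (congrFun h i) j
    simp only [efType, Prod.mk.injEq] at h1
    exact ⟨iff_of_eq h1.1, iff_of_eq h1.2⟩
  · intro h
    funext i j
    exact Prod.ext (propext (h i j).1) (propext (h i j).2)

theorem efType_succ_eq_iff {k : ℕ} : efType G (k + 1) a = efType H (k + 1) b ↔
    efType G k a = efType H k b ∧
    (∀ x, ∃ y, efType G k (Fin.snoc a x : Fin (q + 1) → V) =
      efType H k (Fin.snoc b y : Fin (q + 1) → W)) ∧
    (∀ y, ∃ x, efType G k (Fin.snoc a x : Fin (q + 1) → V) =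
      efType H k (Fin.snoc b y : Fin (q + 1) → W)) := by
  refine Prod.mk_inj.trans (and_congr_right fun _ => ?_)
  refine ⟨fun h => ⟨fun x => ?_, fun y => ?_⟩, fun h => ?_⟩
  · have : efType G k (Fin.snoc a x : Fin (q + 1) → V) ∈
        Set.range fun y => efType H k (Fin.snoc b y : Fin (q + 1) → W) := h ▸ ⟨x, rfl⟩
    obtain ⟨y, hy⟩ := this
    exact ⟨y, hy.symm⟩
  · have : efType H k (Fin.snoc b y : Fin (q + 1) → W) ∈
        Set.range fun x => efType G k (Fin.snoc a x : Fin (q + 1) → V) := h ▸ ⟨y, rfl⟩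
    exact this
  · ext τ
    constructor
    · rintro ⟨x, rfl⟩
      obtain ⟨y, hy⟩ := h.1 x
      exact ⟨y, hy.symm⟩
    · rintro ⟨y, rfl⟩
      exact h.2 y

theorem efType_eq_of_le {k l : ℕ} (hkl : k ≤ l) (h : efType G l a = efType H l b) :
    efType G k a = efType H k b := by
  induction hkl with
  | refl => exact h
  | step _ ih => exact ih (efType_succ_eq_iff.1 h).1

end

theorem snoc_comp_eq {V : Type*} {q r : ℕ} (a : Fin q → V) (f : Fin r → Fin q) (x : V) :
    (Fin.snoc (a ∘ f) x : Fin (r + 1) → V) =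
      (Fin.snoc a x : Fin (q + 1) → V) ∘
        (Fin.snoc (Fin.castSucc ∘ f) (Fin.last q) : Fin (r + 1) → Fin (q + 1)) := by
  funext i
  induction i using Fin.lastCases <;> simp

theorem efType_comp {V W : Type*} {G : SimpleGraph V} {H : SimpleGraph W} (k : ℕ) :
    ∀ {q r : ℕ} {a : Fin q → V} {b : Fin q → W} (f : Fin r → Fin q),
      efType G k a = efType H k b → efType G k (a ∘ f) = efType H k (b ∘ f) := by
  induction k with
  | zero =>
    intro q r a b f h
    rw [efType_zero_eq_iff] at h ⊢
    exact fun i j => h (f i) (f j)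
  | succ k ih =>
    intro q r a b f h
    rw [efType_succ_eq_iff] at h ⊢
    refine ⟨ih f h.1, fun x => ?_, fun y => ?_⟩
    · obtain ⟨y, hy⟩ := h.2.1 x
      refine ⟨y, ?_⟩
      rw [snoc_comp_eq a f x, snoc_comp_eq b f y]
      exact ih _ hy
    · obtain ⟨x, hx⟩ := h.2.2 y
      refine ⟨x, ?_⟩
      rw [snoc_comp_eq a f x, snoc_comp_eq b f y]
      exact ih _ hx

theorem term_realize_eq {q : ℕ} (t : Language.graph.Term (Empty ⊕ Fin q)) :
    ∃ i : Fin q, ∀ (V : Type) (G : SimpleGraph V) (v : Empty → V) (a : Fin q → V),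
      @Language.Term.realize Language.graph V G.structure _ (Sum.elim v a) t = a i := by
  cases t with
  | var x =>
    rcases x with x | i
    · exact x.elim
    · exact ⟨i, fun V G v a => rfl⟩
  | func f _ => exact Empty.elim f

/-- The truth of a first-order formula is determined by an Ehrenfeucht–Fraïssé type. -/
theorem exists_efType_determines {q : ℕ} (φ : Language.graph.BoundedFormula Empty q) :
    ∃ k : ℕ, ∀ (V W : Type) (G : SimpleGraph V) (H : SimpleGraph W) (v : Empty → V)
      (w : Empty → W) (a : Fin q → V) (b : Fin q → W), efType G k a = efType H k b →
      (@Language.BoundedFormula.Realize Language.graph V G.structure _ _ φ v a ↔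
        @Language.BoundedFormula.Realize Language.graph W H.structure _ _ φ w b) := by
  induction φ with
  | falsum => exact ⟨0, fun V W G H v w a b _ => Iff.rfl⟩
  | equal t₁ t₂ =>
    obtain ⟨i, hi⟩ := term_realize_eq t₁
    obtain ⟨j, hj⟩ := term_realize_eq t₂
    refine ⟨0, fun V W G H v w a b h => ?_⟩
    simp only [Language.BoundedFormula.Realize, hi, hj]
    exact (efType_zero_eq_iff.1 h i j).1
  | @rel n l R ts =>
    cases R
    obtain ⟨i, hi⟩ := term_realize_eq (ts 0)
    obtain ⟨j, hj⟩ := term_realize_eq (ts 1)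
    refine ⟨0, fun V W G H v w a b h => ?_⟩
    have key : ∀ (V : Type) (G : SimpleGraph V) (v : Empty → V) (a : Fin n → V),
        @Language.BoundedFormula.Realize Language.graph V G.structure _ _
          (.rel Language.graphRel.adj ts) v a ↔ G.Adj (a i) (a j) := by
      intro V G v a
      rw [← hi V G v a, ← hj V G v a]
      rfl
    rw [key, key]
    exact (efType_zero_eq_iff.1 h i j).2
  | imp φ ψ ih₁ ih₂ =>
    obtain ⟨k₁, h₁⟩ := ih₁
    obtain ⟨k₂, h₂⟩ := ih₂
    refine ⟨max k₁ k₂, fun V W G H v w a b h => ?_⟩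
    simp only [Language.BoundedFormula.Realize]
    exact imp_congr (h₁ V W G H v w a b (efType_eq_of_le (le_max_left _ _) h))
      (h₂ V W G H v w a b (efType_eq_of_le (le_max_right _ _) h))
  | all φ ih =>
    obtain ⟨k, hk⟩ := ih
    refine ⟨k + 1, fun V W G H v w a b h => ?_⟩
    rw [efType_succ_eq_iff] at h
    simp only [Language.BoundedFormula.Realize]
    constructor
    · intro h1 y
      obtain ⟨x, hx⟩ := h.2.2 y
      exact (hk V W G H v w _ _ hx).1 (h1 x)
    · intro h1 x
      obtain ⟨y, hy⟩ := h.2.1 x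
      exact (hk V W G H v w _ _ hy).2 (h1 y)

/-! ### Types after adding a vertex -/

/-- The vertices of `addVertex G S` named by a tuple of vertices of `G`, with `none` naming the new
vertex. -/
def extend {n q : ℕ} (a : Fin q → Fin n) : Option (Fin q) → Fin (n + 1)
  | none => Fin.last n
  | some i => (a i).castSucc

theorem extend_snoc {n q r : ℕ} (a : Fin q → Fin n) (f : Fin r → Option (Fin q)) (v : Fin n) :
    (Fin.snoc (extend a ∘ f) v.castSucc : Fin (r + 1) → Fin (n + 1)) =
      extend (Fin.snoc a v : Fin (q + 1) → Fin n) ∘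
        (Fin.snoc (Option.map Fin.castSucc ∘ f) (some (Fin.last q)) :
          Fin (r + 1) → Option (Fin (q + 1))) := by
  funext i
  induction i using Fin.lastCases with
  | last => simp [extend]
  | cast i =>
    simp only [Fin.snoc_castSucc, Function.comp_apply]
    cases f i <;> simp [extend]

theorem extend_snoc_none {n q r : ℕ} (a : Fin q → Fin n) (f : Fin r → Option (Fin q)) :
    (Fin.snoc (extend a ∘ f) (Fin.last n) : Fin (r + 1) → Fin (n + 1)) =
      extend a ∘ (Fin.snoc f none : Fin (r + 1) → Option (Fin q)) := by
  funext i
  induction i using Fin.lastCases <;> simp [extend]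

theorem image_snoc_map {n q : ℕ} (a : Fin q → Fin n) (v : Fin n) (J : Finset (Fin q)) :
    (J.map Fin.castSuccEmb).image (Fin.snoc a v : Fin (q + 1) → Fin n) = J.image a := by
  ext x
  simp

/-- The answering strategy for `G` and `G'` is kept, and the new vertex answers the new vertex. The
neighbours of the new vertex lie in the named tuple, so equality with an entry of `a` already
decides adjacency to it. The tuple `a` is kept whole while `f` selects what is played, which lets
the induction add one entry per round. -/
theorem efType_addVertex {n n' : ℕ} {G : SimpleGraph (Fin n)} {G' : SimpleGraph (Fin n')} (k : ℕ) :
    ∀ {q r : ℕ} {a : Fin q → Fin n} {a' : Fin q → Fin n'} (J : Finset (Fin q))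
      (f : Fin r → Option (Fin q)), efType G k a = efType G' k a' →
      efType (addVertex G (J.image a)) k (extend a ∘ f) =
        efType (addVertex G' (J.image a')) k (extend a' ∘ f) := by
  induction k with
  | zero =>
    intro q r a a' J f h
    rw [efType_zero_eq_iff] at h ⊢
    intro i j
    have hJ : ∀ i, a i ∈ J.image a ↔ a' i ∈ J.image a' := by
      intro i
      simp only [Finset.mem_image, (h _ _).1]
    simp only [Function.comp_apply]
    rcases f i with _ | i <;> rcases f j with _ | j
    · simp [extend]
    · simp only [extend]
      rw [SimpleGraph.adj_comm, addVertex_adj_last, SimpleGraph.adj_comm _ (Fin.last n'),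
        addVertex_adj_last, hJ j]
      simp [(Fin.castSucc_ne_last _).symm]
    · simp only [extend]
      rw [addVertex_adj_last, addVertex_adj_last, hJ i]
      simp [Fin.castSucc_ne_last]
    · simp only [extend]
      rw [addVertex_adj_castSucc, addVertex_adj_castSucc, Fin.castSucc_inj, Fin.castSucc_inj]
      exact h i j
  | succ k ih =>
    intro q r a a' J f h
    rw [efType_succ_eq_iff] at h ⊢
    refine ⟨ih J f h.1, fun x => ?_, fun y => ?_⟩
    · induction x using Fin.lastCases with
      | last =>
        refine ⟨Fin.last n', ?_⟩
        rw [extend_snoc_none, extend_snoc_none]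
        exact ih J _ h.1
      | cast v =>
        obtain ⟨v', hv⟩ := h.2.1 v
        refine ⟨v'.castSucc, ?_⟩
        rw [extend_snoc, extend_snoc, ← image_snoc_map a v, ← image_snoc_map a' v']
        exact ih _ _ hv
    · induction y using Fin.lastCases with
      | last =>
        refine ⟨Fin.last n, ?_⟩
        rw [extend_snoc_none, extend_snoc_none]
        exact ih J _ h.1
      | cast v' =>
        obtain ⟨v, hv⟩ := h.2.2 v'
        refine ⟨v.castSucc, ?_⟩
        rw [extend_snoc, extend_snoc, ← image_snoc_map a v, ← image_snoc_map a' v']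
        exact ih _ _ hv

/-! ### The finite Markov chain of states -/

section Transitions

open Classical

variable {m n n' k : ℕ}

theorem mem_openVertices {d : ℕ} {G : SimpleGraph (Fin n)} {v : Fin n} :
    v ∈ openVertices d G ↔ G.degree v < d := by
  simp [openVertices]

/-- The degree conditions that the process preserves. -/
structure Admissible (m : ℕ) (G : SimpleGraph (Fin n)) : Prop where
  le_degree : ∀ v, m ≤ G.degree v
  degree_le : ∀ v, G.degree v ≤ 2 * m
  sum_degree : ∑ v, G.degree v + m * (m + 1) = 2 * m * n

theorem Admissible.card_openVertices {G : SimpleGraph (Fin n)} (hG : Admissible m G) (hm : 0 < m) :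
    m < (openVertices (2 * m) G).card :=
  lt_card_openVertices hm G hG.le_degree hG.sum_degree

theorem Admissible.addVertex {G : SimpleGraph (Fin n)} (hG : Admissible m G) {S : Finset (Fin n)}
    (hS : S ∈ (openVertices (2 * m) G).powersetCard m) : Admissible m (addVertex G S) := by
  rw [Finset.mem_powersetCard] at hS
  refine ⟨fun v => ?_, fun v => ?_, ?_⟩
  · induction v using Fin.lastCases with
    | last => rw [degree_addVertex_last, hS.2]
    | cast v =>
      rw [degree_addVertex_castSucc]
      exact (hG.le_degree v).trans (Nat.le_add_right _ _)
  · induction v using Fin.lastCases with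
    | last => rw [degree_addVertex_last, hS.2]; omega
    | cast v =>
      rw [degree_addVertex_castSucc]
      have := hG.degree_le v
      split_ifs with hv
      · have := mem_openVertices.1 (hS.1 hv)
        omega
      · omega
  · have := hG.sum_degree
    rw [Fin.sum_univ_castSucc, degree_addVertex_last, hS.2]
    simp only [degree_addVertex_castSucc]
    rw [Finset.sum_add_distrib]
    simp only [Finset.sum_ite_mem, Finset.univ_inter, Finset.sum_const, hS.2, smul_eq_mul, mul_one]
    linarith

theorem admissible_of_mem_support (hm : 0 < m) (t : ℕ) :
    ∀ G ∈ (law m (2 * m) t).support, Admissible m G := by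
  induction t with
  | zero =>
    intro G hG
    obtain ⟨h1, h2⟩ := degrees_of_mem_support hm 0 G hG
    refine ⟨h1, fun v => ?_, h2⟩
    have := G.degree_lt_card_verts v
    rw [Fintype.card_fin] at this
    omega
  | succ t ih =>
    intro G hG
    simp only [law, PMF.mem_support_bind_iff] at hG
    obtain ⟨H, hH, hG⟩ := hG
    have hc := (ih H hH).card_openVertices hm
    have hne : ((openVertices (2 * m) H).powersetCard m).Nonempty :=
      Finset.powersetCard_nonempty.2 hc.le
    rw [step, dif_pos hne, PMF.mem_support_map_iff] at hG
    obtain ⟨S, hS, rfl⟩ := hG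
    rw [PMF.mem_support_uniformOfFinset_iff] at hS
    exact (ih H hH).addVertex hS

/-- A list of half-edges still to be used: each vertex occurs as often as its degree falls short
of `2 * m`. -/
def IsStubs (m : ℕ) (G : SimpleGraph (Fin n)) (a : Fin (m * (m + 1)) → Fin n) : Prop :=
  ∀ v, G.degree v + (Finset.univ.filter fun i => a i = v).card = 2 * m

theorem exists_card_fiber_eq {K : ℕ} (e : Fin n → ℕ) (he : ∑ v, e v = K) :
    ∃ a : Fin K → Fin n, ∀ v, (Finset.univ.filter fun i => a i = v).card = e v := by
  have hcard : Fintype.card (Fin K) = Fintype.card (Σ v, Fin (e v)) := by simp [he]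
  let σ := Fintype.equivOfCardEq hcard
  refine ⟨fun i => (σ i).1, fun v => ?_⟩
  have : (Finset.univ.filter fun i => (σ i).1 = v) =
      (Finset.univ : Finset (Fin (e v))).image fun j => σ.symm ⟨v, j⟩ := by
    ext i
    simp only [Finset.mem_filter, Finset.mem_univ, true_and, Finset.mem_image]
    constructor
    · rintro rfl
      exact ⟨(σ i).2, by simp⟩
    · rintro ⟨j, rfl⟩
      simp
  rw [this, Finset.card_image_of_injective, Finset.card_univ, Fintype.card_fin]
  intro j j' h
  simpa using h

theorem exists_perm_of_card_fiber_eq {α β : Type*} [Fintype α] [DecidableEq β]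
    {a b : α → β}
    (h : ∀ v, (Finset.univ.filter fun i => a i = v).card =
      (Finset.univ.filter fun i => b i = v).card) : ∃ σ : Equiv.Perm α, b = a ∘ σ := by
  have e : ∀ v : β, Nonempty ({i // b i = v} ≃ {i // a i = v}) := fun v =>
    ⟨Fintype.equivOfCardEq (by rw [Fintype.card_subtype, Fintype.card_subtype, h v])⟩
  replace e := fun v => Classical.choice (e v)
  refine ⟨(Equiv.sigmaFiberEquiv b).symm.trans
    ((Equiv.sigmaCongrRight e).trans (Equiv.sigmaFiberEquiv a)), ?_⟩
  funext i
  exact ((e (b i)) ⟨i, rfl⟩).2.symm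

theorem Admissible.exists_isStubs {G : SimpleGraph (Fin n)} (hG : Admissible m G) :
    ∃ a, IsStubs m G a := by
  have hsum : ∑ v, (2 * m - G.degree v) = m * (m + 1) := by
    have h1 : ∑ v, (2 * m - G.degree v) + ∑ v, G.degree v = 2 * m * n := by
      rw [← Finset.sum_add_distrib, Finset.sum_congr rfl fun v _ => Nat.sub_add_cancel
        (hG.degree_le v)]
      simp [mul_comm]
    have := hG.sum_degree
    omega
  obtain ⟨a, ha⟩ := exists_card_fiber_eq _ hsum
  refine ⟨a, fun v => ?_⟩
  have := hG.degree_le v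
  have := ha v
  omega

/-- The set of Ehrenfeucht–Fraïssé types of the lists of unused half-edges of `G`. -/
def state (m k : ℕ) (G : SimpleGraph (Fin n)) : Set (EFType k (m * (m + 1))) :=
  {τ | ∃ a, IsStubs m G a ∧ efType G k a = τ}

/-- Any two lists of half-edges of one graph differ by a permutation of indices, and the same
permutation can be applied on the other side. One common type therefore forces equal states. -/
theorem state_eq_of_efType_eq {G : SimpleGraph (Fin n)} {G' : SimpleGraph (Fin n')}
    {a : Fin (m * (m + 1)) → Fin n} {a' : Fin (m * (m + 1)) → Fin n'} (ha : IsStubs m G a)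
    (ha' : IsStubs m G' a') (h : efType G k a = efType G' k a') : state m k G = state m k G' := by
  have key : ∀ {n n' : ℕ} {G : SimpleGraph (Fin n)} {G' : SimpleGraph (Fin n')}
      {a : Fin (m * (m + 1)) → Fin n} {a' : Fin (m * (m + 1)) → Fin n'}, IsStubs m G a →
      IsStubs m G' a' → efType G k a = efType G' k a' → state m k G ⊆ state m k G' := by
    rintro n n' G G' a a' ha ha' h τ ⟨b, hb, rfl⟩
    obtain ⟨σ, rfl⟩ := exists_perm_of_card_fiber_eq (a := a) (b := b) fun v => by
      have := ha v
      have := hb v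
      omega
    refine ⟨a' ∘ σ, fun v => ?_, (efType_comp k σ h).symm⟩
    rw [← ha' v]
    congr 1
    refine Finset.card_bij (fun i _ => σ i) (by simp) (by simp) fun i hi => ⟨σ.symm i, ?_⟩
    simpa using hi
  exact (key ha ha' h).antisymm (key ha' ha h.symm)

/-- The first occurrences in a tuple. -/
noncomputable def firsts {K : ℕ} {V : Type*} (a : Fin K → V) : Finset (Fin K) :=
  Finset.univ.filter fun i => ∀ j < i, a j ≠ a i

theorem injOn_firsts {K : ℕ} {V : Type*} (a : Fin K → V) : Set.InjOn a (firsts a) := by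
  intro i hi j hj h
  simp only [firsts, Finset.coe_filter, Finset.mem_univ, true_and, Set.mem_ofPred_eq] at hi hj
  rcases lt_trichotomy i j with hij | hij | hij
  · exact absurd h (hj i hij)
  · exact hij
  · exact absurd h.symm (hi j hij)

theorem image_firsts {K : ℕ} {V : Type*} [DecidableEq V] (a : Fin K → V) :
    (firsts a).image a = Finset.univ.image a := by
  ext v
  simp only [Finset.mem_image, Finset.mem_univ, true_and]
  constructor
  · rintro ⟨i, _, rfl⟩
    exact ⟨i, rfl⟩
  · rintro ⟨i, rfl⟩
    induction i using WellFoundedLT.induction with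
    | ind i ih =>
      by_cases hi : ∀ j < i, a j ≠ a i
      · exact ⟨i, by simpa [firsts] using hi, rfl⟩
      · push Not at hi
        obtain ⟨j, hj, h⟩ := hi
        obtain ⟨l, hl, hl'⟩ := ih j hj
        exact ⟨l, hl, hl'.trans h⟩

theorem IsStubs.image_firsts {G : SimpleGraph (Fin n)} {a : Fin (m * (m + 1)) → Fin n}
    (ha : IsStubs m G a) : (firsts a).image a = openVertices (2 * m) G := by
  rw [UniformAttachment.image_firsts]
  ext v
  rw [mem_openVertices, ← ha v, Nat.lt_add_right_iff_pos, Finset.card_pos]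
  simp [Finset.Nonempty]

theorem powersetCard_image_eq {α β : Type*} [DecidableEq β] {s : Finset α} {a : α → β} (ha : Set.InjOn a s)
    (m : ℕ) : (s.image a).powersetCard m = (s.powersetCard m).image (Finset.image a) := by
  ext S
  simp only [Finset.mem_powersetCard, Finset.mem_image]
  constructor
  · rintro ⟨h1, h2⟩
    obtain ⟨J, hJ, rfl⟩ := Finset.subset_image_iff.1 h1
    refine ⟨J, ⟨hJ, ?_⟩, rfl⟩
    rwa [Finset.card_image_of_injOn (ha.mono hJ)] at h2
  · rintro ⟨J, ⟨h1, h2⟩, rfl⟩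
    refine ⟨Finset.image_subset_image h1, ?_⟩
    rw [Finset.card_image_of_injOn (ha.mono h1), h2]

theorem sum_powersetCard_image {α β M : Type*} [DecidableEq β] [AddCommMonoid M]
    {s : Finset α} {a : α → β}
    (ha : Set.InjOn a s) (m : ℕ) (F : Finset β → M) :
    ∑ S ∈ (s.image a).powersetCard m, F S = ∑ J ∈ s.powersetCard m, F (J.image a) := by
  rw [powersetCard_image_eq ha, Finset.sum_image]
  intro J hJ J' hJ' h
  have h1 := (Finset.mem_powersetCard.1 hJ).1
  have h2 := (Finset.mem_powersetCard.1 hJ').1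
  exact Finset.image_injOn_powerset_of_injOn ha (by simpa using h1) (by simpa using h2) h

/-- The new vertex has degree `m`, hence deficiency `m`, exactly the number of half-edges consumed;
overwriting these entries by the new vertex keeps the list complete. -/
theorem IsStubs.addVertex {G : SimpleGraph (Fin n)} {a : Fin (m * (m + 1)) → Fin n}
    (ha : IsStubs m G a) {J : Finset (Fin (m * (m + 1)))} (hinj : Set.InjOn a J)
    (hJ : J.card = m) :
    IsStubs m (addVertex G (J.image a))
      (extend a ∘ fun i => if i ∈ J then none else some i) := by
  intro v
  induction v using Fin.lastCases with
  | last =>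
    rw [degree_addVertex_last, Finset.card_image_of_injOn hinj, hJ]
    have : (Finset.univ.filter fun i =>
        (extend a ∘ fun i => if i ∈ J then none else some i) i = Fin.last n) = J := by
      ext i
      rw [Finset.mem_filter, Function.comp_apply]
      by_cases hi : i ∈ J <;> simp [hi, extend, Fin.castSucc_ne_last]
    rw [this, hJ]
    omega
  | cast v =>
    rw [degree_addVertex_castSucc, ← ha v, add_assoc]
    congr 1
    have h1 : (Finset.univ.filter fun i =>
        (extend a ∘ fun i => if i ∈ J then none else some i) i = v.castSucc) =
        (Finset.univ.filter fun i => a i = v) \ J := by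
      ext i
      rw [Finset.mem_sdiff, Finset.mem_filter, Finset.mem_filter, Function.comp_apply]
      by_cases hi : i ∈ J <;> simp [hi, extend, (Fin.castSucc_ne_last v).symm]
    have h2 : (if v ∈ J.image a then 1 else 0) = (J ∩ Finset.univ.filter fun i => a i = v).card := by
      split_ifs with hv
      · obtain ⟨i, hi, rfl⟩ := Finset.mem_image.1 hv
        refine (Finset.card_eq_one.2 ⟨i, ?_⟩).symm
        ext j
        simp only [Finset.mem_inter, Finset.mem_filter, Finset.mem_univ, true_and,
          Finset.mem_singleton]
        exact ⟨fun h => hinj h.1 hi h.2, by rintro rfl; exact ⟨hi, rfl⟩⟩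
      · refine (Finset.card_eq_zero.2 ?_).symm
        ext j
        simp only [Finset.mem_inter, Finset.mem_filter, Finset.mem_univ, true_and]
        refine ⟨fun h => absurd (Finset.mem_image.2 ⟨j, h⟩) hv, fun h => absurd h (by simp)⟩
    rw [h1, h2, Finset.card_sdiff, add_comm]
    exact Nat.sub_add_cancel (Finset.card_le_card Finset.inter_subset_right)

/-- The expected value of a function of the state after one step of the process. -/
noncomputable def stepMean (m k : ℕ) (G : SimpleGraph (Fin n))
    (h : Set (EFType k (m * (m + 1))) → ℂ) : ℂ :=
  (∑ S ∈ (openVertices (2 * m) G).powersetCard m, h (state m k (addVertex G S))) /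
    ((openVertices (2 * m) G).powersetCard m).card

/-- First occurrences index each open vertex once, so the choice of `m` vertices becomes a choice of
`m` indices, comparable between different graphs. -/
theorem stepMean_eq_sum_firsts {G : SimpleGraph (Fin n)} {a : Fin (m * (m + 1)) → Fin n}
    (ha : IsStubs m G a) (h : Set (EFType k (m * (m + 1))) → ℂ) :
    stepMean m k G h = (∑ J ∈ (firsts a).powersetCard m,
      h (state m k (addVertex G (J.image a)))) / ((firsts a).powersetCard m).card := by
  rw [stepMean, ← ha.image_firsts, sum_powersetCard_image (injOn_firsts a),
    Finset.card_powersetCard, Finset.card_powersetCard,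
    Finset.card_image_of_injOn (injOn_firsts a)]

/-- The state is a Markov chain: the law of the next state depends only on the present one. -/
theorem stepMean_eq_of_state_eq {G : SimpleGraph (Fin n)} {G' : SimpleGraph (Fin n')}
    (hG : Admissible m G) (hs : state m k G = state m k G')
    (h : Set (EFType k (m * (m + 1))) → ℂ) : stepMean m k G h = stepMean m k G' h := by
  obtain ⟨a, ha⟩ := hG.exists_isStubs
  have : efType G k a ∈ state m k G' := hs ▸ ⟨a, ha, rfl⟩
  obtain ⟨a', ha', he⟩ := this
  have h0 := efType_zero_eq_iff.1 (efType_eq_of_le (Nat.zero_le k) he)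
  -- First occurrences depend only on the equality pattern, which is part of the rank-zero type.
  have hf : firsts a = firsts a' := by
    ext i
    simp only [firsts, Finset.mem_filter, Finset.mem_univ, true_and, ne_eq, (h0 _ _).1]
  rw [stepMean_eq_sum_firsts ha, stepMean_eq_sum_firsts ha', hf]
  congr 1
  refine Finset.sum_congr rfl fun J hJ => congrArg h ?_
  obtain ⟨hJ1, hJ2⟩ := Finset.mem_powersetCard.1 hJ
  exact state_eq_of_efType_eq (ha.addVertex ((injOn_firsts a).mono (hf ▸ hJ1)) hJ2)
    (ha'.addVertex ((injOn_firsts a').mono hJ1) hJ2) (efType_addVertex k J _ he.symm)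

/-- The transition operator of the Markov chain of states, made total by never leaving a set that
is not the state of any admissible graph. -/
noncomputable def transition (m k : ℕ) :
    Module.End ℂ (Set (EFType k (m * (m + 1))) → ℂ) where
  toFun h τ := if hτ : ∃ X : Σ n, SimpleGraph (Fin n), Admissible m X.2 ∧ state m k X.2 = τ then
    stepMean m k hτ.choose.2 h else h τ
  map_add' h h' := by
    funext τ
    simp only [Pi.add_apply]
    split_ifs
    · simp only [stepMean, Pi.add_apply, Finset.sum_add_distrib, add_div]
    · rfl
  map_smul' c h := by
    funext τ
    simp only [Pi.smul_apply, RingHom.id_apply]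
    split_ifs
    · simp only [stepMean, Pi.smul_apply, smul_eq_mul, ← Finset.mul_sum, mul_div_assoc]
    · rfl

theorem transition_apply_state {G : SimpleGraph (Fin n)} (hG : Admissible m G)
    (h : Set (EFType k (m * (m + 1))) → ℂ) :
    transition m k h (state m k G) = stepMean m k G h := by
  have hτ : ∃ X : Σ n, SimpleGraph (Fin n), Admissible m X.2 ∧ state m k X.2 = state m k G :=
    ⟨⟨n, G⟩, hG, rfl⟩
  exact (dif_pos hτ).trans (stepMean_eq_of_state_eq hτ.choose_spec.1 hτ.choose_spec.2 h)

theorem transition_apply_of_not_exists {τ : Set (EFType k (m * (m + 1)))}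
    (hτ : ¬ ∃ X : Σ n, SimpleGraph (Fin n), Admissible m X.2 ∧ state m k X.2 = τ)
    (h : Set (EFType k (m * (m + 1))) → ℂ) : transition m k h τ = h τ :=
  dif_neg hτ

theorem norm_stepMean_le {G : SimpleGraph (Fin n)} (h : Set (EFType k (m * (m + 1))) → ℂ) {c : ℝ}
    (hc : 0 ≤ c) (hh : ∀ τ, ‖h τ‖ ≤ c) : ‖stepMean m k G h‖ ≤ c := by
  rw [stepMean, norm_div, Complex.norm_natCast]
  refine div_le_of_le_mul₀ (Nat.cast_nonneg _) hc ?_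
  refine (norm_sum_le_of_le _ fun S _ => hh _).trans ?_
  rw [Finset.sum_const, nsmul_eq_mul, mul_comm]

noncomputable instance fintype_set_efType (k q : ℕ) : Fintype (Set (EFType k q)) :=
  Fintype.ofFinite _

theorem norm_transition_le (h : Set (EFType k (m * (m + 1))) → ℂ) : ‖transition m k h‖ ≤ ‖h‖ := by
  refine (pi_norm_le_iff_of_nonneg (norm_nonneg h)).2 fun τ => ?_
  by_cases hτ : ∃ X : Σ n, SimpleGraph (Fin n), Admissible m X.2 ∧ state m k X.2 = τ
  · obtain ⟨X, hX, rfl⟩ := hτ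
    rw [transition_apply_state hX]
    exact norm_stepMean_le h (norm_nonneg h) (norm_le_pi_norm h)
  · rw [transition_apply_of_not_exists hτ]
    exact norm_le_pi_norm h τ

end Transitions

/-! ### Strips: always joining to the last `m` vertices -/

section Strips

open Classical

variable {m n k : ℕ}

/-- The last `i` vertices. -/
def lastVertices (i n : ℕ) : Finset (Fin n) :=
  Finset.univ.filter fun v => n ≤ v + i

theorem mem_lastVertices {i n : ℕ} {v : Fin n} : v ∈ lastVertices i n ↔ n ≤ v + i := by
  simp [lastVertices]

theorem card_lastVertices_le (i n : ℕ) : (lastVertices i n).card ≤ i := by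
  have h : ∀ v ∈ lastVertices i n, n - 1 - v.1 ∈ Finset.range i := by
    intro v hv
    have := mem_lastVertices.1 hv
    have := v.2
    rw [Finset.mem_range]
    omega
  have := Finset.card_le_card_of_injOn (fun v : Fin n => n - 1 - v.1) h (by
    intro v _ w _ hvw
    have := v.2
    have := w.2
    simp only at hvw
    exact Fin.ext (by omega))
  simpa using this

theorem card_lastVertices {i n : ℕ} (h : i ≤ n) : (lastVertices i n).card = i := by
  refine (card_lastVertices_le i n).antisymm ?_
  rcases Nat.eq_zero_or_pos i with rfl | hi
  · simp
  have := Finset.card_le_card_of_injOn (s := (Finset.univ : Finset (Fin i)))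
    (t := lastVertices i n) (fun j : Fin i => (⟨n - 1 - j.1, by omega⟩ : Fin n)) (by
      intro j _
      have := j.2
      rw [Finset.mem_coe, mem_lastVertices]
      simp only
      omega) (by
      intro j _ j' _ h
      have := j.2
      have := j'.2
      simp only [Fin.mk.injEq] at h
      exact Fin.ext (by omega))
  simpa using this

/-- The last `i` vertices have degrees `m + i - 1, …, m + 1, m`. -/
def HasTail (m i : ℕ) (G : SimpleGraph (Fin n)) : Prop :=
  ∀ v : Fin n, n ≤ v + i → G.degree v + v + 1 = m + n

theorem HasTail.addVertex {i : ℕ} {G : SimpleGraph (Fin n)} (hG : HasTail m i G)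
    {S : Finset (Fin n)} (hS : lastVertices i n ⊆ S) (hc : S.card = m) :
    HasTail m (i + 1) (addVertex G S) := by
  intro v hv
  induction v using Fin.lastCases with
  | last => rw [degree_addVertex_last, hc, Fin.val_last]; omega
  | cast v =>
    have h1 : n ≤ v + i := by simp only [Fin.val_castSucc] at hv; omega
    have := hG v h1
    rw [degree_addVertex_castSucc, if_pos (hS (mem_lastVertices.2 h1)), Fin.val_castSucc]
    omega

theorem HasTail.lastVertices_subset {i : ℕ} (hi : i ≤ m) {G : SimpleGraph (Fin n)}
    (hG : HasTail m i G) : lastVertices i n ⊆ openVertices (2 * m) G := by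
  intro v hv
  have h1 := mem_lastVertices.1 hv
  have h2 := hG v h1
  rw [mem_openVertices]
  omega

/-- The graph obtained from `G` by `N` times joining a new vertex to the last `m` vertices. -/
noncomputable def strip (m : ℕ) (G : SimpleGraph (Fin n)) :
    (N : ℕ) → SimpleGraph (Fin (n + N))
  | 0 => G
  | N + 1 => UniformAttachment.addVertex (strip m G N) (lastVertices m (n + N))

theorem strip_adj (G : SimpleGraph (Fin n)) (N : ℕ) (u v : Fin (n + N)) :
    (strip m G N).Adj u v ↔
      (∃ (hu : u.1 < n) (hv : v.1 < n), G.Adj ⟨u, hu⟩ ⟨v, hv⟩) ∨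
      (u.1 ≠ v.1 ∧ (n ≤ u.1 ∨ n ≤ v.1) ∧ u.1 ≤ v.1 + m ∧ v.1 ≤ u.1 + m) := by
  induction N with
  | zero =>
    have hu : u.1 < n := u.2
    have hv : v.1 < n := v.2
    constructor
    · exact fun h => Or.inl ⟨hu, hv, h⟩
    · rintro (⟨_, _, h⟩ | h)
      · exact h
      · omega
  | succ N ih =>
    have hlast : ∀ u : Fin (n + N), (strip m G (N + 1)).Adj u.castSucc (Fin.last (n + N)) ↔
        n + N ≤ u.1 + m := fun u => (addVertex_adj_last _ _ _).trans mem_lastVertices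
    rcases Fin.eq_castSucc_or_eq_last (n := n + N) u with ⟨u, rfl⟩ | rfl
    · rcases Fin.eq_castSucc_or_eq_last (n := n + N) v with ⟨v, rfl⟩ | rfl
      · exact (addVertex_adj_castSucc _ _ _ _).trans (ih u v)
      · rw [hlast, Fin.val_last, Fin.val_castSucc]
        have := u.2
        constructor
        · intro h; right; omega
        · rintro (⟨_, h, _⟩ | h) <;> omega
    · rcases Fin.eq_castSucc_or_eq_last (n := n + N) v with ⟨v, rfl⟩ | rfl
      · rw [SimpleGraph.adj_comm, hlast, Fin.val_last, Fin.val_castSucc]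
        have := v.2
        constructor
        · intro h; right; omega
        · rintro (⟨h, _⟩ | h) <;> omega
      · simp

theorem HasTail.strip {G : SimpleGraph (Fin n)} (hG : HasTail m m G) (hn : m ≤ n) (N : ℕ) :
    HasTail m m (strip m G N) := by
  induction N with
  | zero => exact hG
  | succ N ih =>
    intro v hv
    exact ih.addVertex subset_rfl (card_lastVertices (by omega)) v (by omega)

theorem HasTail.lastVertices_mem {G : SimpleGraph (Fin n)} (hG : HasTail m m G) (hn : m ≤ n)
    (N : ℕ) : lastVertices m (n + N) ∈
      (openVertices (2 * m) (UniformAttachment.strip m G N)).powersetCard m :=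
  Finset.mem_powersetCard.2 ⟨(hG.strip hn N).lastVertices_subset le_rfl,
    card_lastVertices (by omega)⟩

/-- Vertices before the last `m` of `G` receive no further edge; any other one starts its life in
the tail with degree `m` and gains one edge from each of its next `m` successors. -/
theorem degree_strip {G : SimpleGraph (Fin n)} (hG : HasTail m m G) (N : ℕ) (hn : m ≤ n)
    (v : Fin (n + N)) : (strip m G N).degree v =
      if h : v.1 + m < n then G.degree ⟨v, by omega⟩ else min (2 * m) (m + (n + N - 1 - v)) := by
  induction N with
  | zero =>
    split_ifs with h
    · rfl
    · have hv : v.1 < n := v.2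
      have : (UniformAttachment.strip m G 0).degree v + v + 1 = m + n := hG v (by omega)
      omega
  | succ N ih =>
    have hc : (lastVertices m (n + N)).card = m := card_lastVertices (by omega)
    rcases Fin.eq_castSucc_or_eq_last (n := n + N) v with ⟨v, rfl⟩ | rfl
    · have h1 : (strip m G (N + 1)).degree v.castSucc = (strip m G N).degree v +
          if v ∈ lastVertices m (n + N) then 1 else 0 := degree_addVertex_castSucc _ _ _
      rw [h1, ih v]
      simp only [mem_lastVertices, Fin.val_castSucc]
      have := v.2
      split_ifs <;> omega
    · have h1 : (strip m G (N + 1)).degree (Fin.last (n + N)) = m :=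
        (degree_addVertex_last _ _).trans hc
      rw [dif_neg (by rw [Fin.val_last]; omega), h1, Fin.val_last]
      omega

/-- The unused half-edges of a strip: those of the original graph, moved along with its end. -/
def stripStubs (m N : ℕ) {q : ℕ} (a : Fin q → Fin n) (i : Fin q) : Fin (n + N) :=
  ⟨if (a i).1 + m < n then a i else a i + N, by have := (a i).2; split_ifs <;> omega⟩

theorem IsStubs.strip {G : SimpleGraph (Fin n)} (hG : HasTail m m G) (hn : m ≤ n)
    {a : Fin (m * (m + 1)) → Fin n} (ha : IsStubs m G a) (N : ℕ) :
    IsStubs m (strip m G N) (stripStubs m N a) := by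
  intro v
  have hv := v.2
  rw [degree_strip hG N hn]
  split_ifs with h1
  · rw [← ha ⟨v, by omega⟩]
    congr 2
    ext i
    simp only [Finset.mem_filter, Finset.mem_univ, true_and, stripStubs, Fin.ext_iff]
    split_ifs <;> omega
  · by_cases h2 : v.1 + m < n + N
    · have : (Finset.univ.filter fun i => stripStubs m N a i = v) = ∅ := by
        ext i
        have := (a i).2
        simp only [Finset.mem_filter, Finset.mem_univ, true_and, stripStubs, Fin.ext_iff,
          Finset.notMem_empty, iff_false]
        split_ifs <;> omega
      rw [this, Finset.card_empty]
      omega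
    · have h3 := ha ⟨v - N, by omega⟩
      have h4 := hG ⟨v - N, by omega⟩ (by simp only; omega)
      have : (Finset.univ.filter fun i => stripStubs m N a i = v) =
          Finset.univ.filter fun i => a i = ⟨v - N, by omega⟩ := by
        ext i
        have := (a i).2
        simp only [Finset.mem_filter, Finset.mem_univ, true_and, stripStubs, Fin.ext_iff]
        split_ifs <;> omega
      rw [this]
      simp only at h3 h4
      omega

end Strips

/-! ### The Ehrenfeucht–Fraïssé game on two long strips -/

section Game

variable {n k : ℕ}

/-- Positions `x < R` and `y < R'` agree if they have the same distance, up to the threshold `D`,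
to the first `n` positions and to the end. -/
def EndsAgree (D n R R' x y : ℕ) : Prop :=
  (x < n + D ∨ y < n + D → x = y) ∧ (R ≤ x + D ∨ R' ≤ y + D → x + R' = y + R)

/-- The displacements from `x₂` to `x` and from `y₂` to `y` agree up to the threshold `D`. -/
def GapsAgree (D x y x₂ y₂ : ℕ) : Prop :=
  (x ≤ x₂ + D ∧ x₂ ≤ x + D) ∨ (y ≤ y₂ + D ∧ y₂ ≤ y + D) → x + y₂ = y + x₂

theorem EndsAgree.symm {D n R R' x y : ℕ} (h : EndsAgree D n R R' x y) :
    EndsAgree D n R' R y x := by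
  unfold EndsAgree at *; omega

theorem GapsAgree.symm {D x y x₂ y₂ : ℕ} (h : GapsAgree D x y x₂ y₂) :
    GapsAgree D y x y₂ x₂ := by
  unfold GapsAgree at *; omega

theorem GapsAgree.swap {D x y x₂ y₂ : ℕ} (h : GapsAgree D x y x₂ y₂) :
    GapsAgree D x₂ y₂ x y := by
  unfold GapsAgree at *; omega

/-- Each `c i` excludes at most `2 * D + 1` positions. -/
theorem exists_far {q : ℕ} (c : Fin q → ℕ) {D N : ℕ} (L : ℕ) (h : q * (2 * D + 1) < N) :
    ∃ y, L ≤ y ∧ y < L + N ∧ ∀ i, y + D < c i ∨ c i + D < y := by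
  by_contra! hcon
  have hsub : Finset.Ico L (L + N) ⊆
      Finset.univ.biUnion fun i => Finset.Icc (c i - D) (c i + D) := by
    intro y hy
    rw [Finset.mem_Ico] at hy
    obtain ⟨i, h1, h2⟩ := hcon y hy.1 hy.2
    rw [Finset.mem_biUnion]
    exact ⟨i, Finset.mem_univ i, Finset.mem_Icc.2 ⟨by omega, by omega⟩⟩
  have h1 := Finset.card_le_card hsub
  have h2 : (Finset.univ.biUnion fun i => Finset.Icc (c i - D) (c i + D)).card ≤
      (Finset.univ : Finset (Fin q)).card * (2 * D + 1) :=
    Finset.card_biUnion_le_card_mul _ _ _ fun i _ => by rw [Nat.card_Icc]; omega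
  rw [Nat.card_Ico, Finset.card_univ, Fintype.card_fin] at *
  omega

/-- One round of the game, halving the threshold. A move near the beginning, the end or an earlier
position is copied with the same displacement, and the doubled threshold makes the copy consistent
with everything else. A move far from all of these is answered by any position equally isolated. -/
theorem exists_agreeing {q D N N' : ℕ} {b b' : Fin q → ℕ} (hb' : ∀ i, b' i < n + N')
    (he : ∀ i, EndsAgree (2 * D) n (n + N) (n + N') (b i) (b' i))
    (hg : ∀ i j, GapsAgree (2 * D) (b i) (b' i) (b j) (b' j))
    (hN : (q + 2) * (4 * D + 1) ≤ N) (hN' : (q + 2) * (4 * D + 1) ≤ N') {x : ℕ} (hx : x < n + N) :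
    ∃ y < n + N', EndsAgree D n (n + N) (n + N') x y ∧ ∀ i, GapsAgree D x y (b i) (b' i) := by
  have h1 : q * (2 * D + 1) + (8 * D + 2) ≤ (q + 2) * (4 * D + 1) := by nlinarith
  by_cases hl : x < n + D
  · refine ⟨x, by omega, ?_, fun i => ?_⟩
    · unfold EndsAgree; omega
    · have := he i; unfold EndsAgree at this; unfold GapsAgree; omega
  by_cases hr : n + N ≤ x + D
  · refine ⟨x + N' - N, by omega, ?_, fun i => ?_⟩
    · unfold EndsAgree; omega
    · have := hb' i; have := he i; unfold EndsAgree at this; unfold GapsAgree; omega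
  by_cases hc : ∃ i, x ≤ b i + D ∧ b i ≤ x + D
  · obtain ⟨i, hi⟩ := hc
    have hei := he i
    have hbi := hb' i
    unfold EndsAgree at hei
    refine ⟨b' i + x - b i, by omega, ?_, fun j => ?_⟩
    · unfold EndsAgree; omega
    · have hgij := hg i j
      unfold GapsAgree at *
      omega
  · push Not at hc
    obtain ⟨y, hy1, hy2, hy3⟩ := exists_far b' (N := N' - 2 * D) (D := D) (n + D) (by omega)
    refine ⟨y, by omega, ?_, fun i => ?_⟩
    · unfold EndsAgree; omega
    · have := hy3 i
      have := hc i
      unfold GapsAgree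
      omega

/-- At rank zero the threshold is `m`, the reach of the edges in the strip; each further round
doubles it. Positions in the original graph are always matched with themselves. -/
theorem efType_strip_eq {m : ℕ} (G : SimpleGraph (Fin n)) {N N' : ℕ} (k : ℕ) :
    ∀ {q : ℕ} (b : Fin q → Fin (n + N)) (b' : Fin q → Fin (n + N')),
      (∀ i, EndsAgree (m * 2 ^ k) n (n + N) (n + N') (b i) (b' i)) →
      (∀ i j, GapsAgree (m * 2 ^ k) (b i) (b' i) (b j) (b' j)) →
      (q + k + 1) * (2 * (m * 2 ^ k) + 1) ≤ N → (q + k + 1) * (2 * (m * 2 ^ k) + 1) ≤ N' →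
      efType (strip m G N) k b = efType (strip m G N') k b' := by
  induction k with
  | zero =>
    intro q b b' he hg _ _
    rw [efType_zero_eq_iff]
    intro i j
    have hei := he i
    have hej := he j
    have hgij := hg i j
    simp only [pow_zero, mul_one, EndsAgree, GapsAgree] at hei hej hgij
    rw [Fin.ext_iff, Fin.ext_iff]
    refine ⟨by omega, ?_⟩
    rw [strip_adj, strip_adj]
    refine or_congr ⟨?_, ?_⟩ (by omega)
    · rintro ⟨hi, hj, h⟩
      have h1 : (b i).1 = b' i := by omega
      have h2 : (b j).1 = b' j := by omega
      refine ⟨by omega, by omega, ?_⟩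
      convert h using 2 <;> omega
    · rintro ⟨hi, hj, h⟩
      have h1 : (b i).1 = b' i := by omega
      have h2 : (b j).1 = b' j := by omega
      refine ⟨by omega, by omega, ?_⟩
      convert h using 2
  | succ k ih =>
    intro q b b' he hg hN hN'
    have hD : m * 2 ^ (k + 1) = 2 * (m * 2 ^ k) := by ring
    rw [hD] at he hg hN hN'
    generalize hDk : m * 2 ^ k = D at *
    have hsize : ∀ {M : ℕ}, (q + (k + 1) + 1) * (2 * (2 * D) + 1) ≤ M →
        (q + 2) * (4 * D + 1) ≤ M ∧ (q + k + 1) * (2 * D + 1) ≤ M ∧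
          (q + 1 + k + 1) * (2 * D + 1) ≤ M := by
      intro M hM
      refine ⟨le_trans ?_ hM, le_trans ?_ hM, le_trans ?_ hM⟩ <;>
        exact Nat.mul_le_mul (by omega) (by omega)
    have step : ∀ (x : Fin (n + N)) (y : Fin (n + N')), EndsAgree D n (n + N) (n + N') x y →
        (∀ i, GapsAgree D x y (b i) (b' i)) →
        efType (strip m G N) k (Fin.snoc b x : Fin (q + 1) → Fin (n + N)) =
          efType (strip m G N') k (Fin.snoc b' y : Fin (q + 1) → Fin (n + N')) := by
      intro x y hxy hgxy
      refine ih _ _ (fun i => ?_) (fun i j => ?_) (hsize hN).2.2 (hsize hN').2.2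
      · induction i using Fin.lastCases with
        | last => simpa using hxy
        | cast i =>
          have := he i
          simp only [Fin.snoc_castSucc]
          unfold EndsAgree at *
          omega
      · induction i using Fin.lastCases with
        | last =>
          induction j using Fin.lastCases with
          | last => simp [GapsAgree, add_comm]
          | cast j => simpa using hgxy j
        | cast i =>
          induction j using Fin.lastCases with
          | last => simpa using (hgxy i).swap
          | cast j =>
            have := hg i j
            simp only [Fin.snoc_castSucc]
            unfold GapsAgree at *
            omega
    rw [efType_succ_eq_iff]
    refine ⟨ih b b' (fun i => ?_) (fun i j => ?_) (hsize hN).2.1 (hsize hN').2.1, fun x => ?_,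
      fun y => ?_⟩
    · have := he i
      unfold EndsAgree at *
      omega
    · have := hg i j
      unfold GapsAgree at *
      omega
    · obtain ⟨y, hy, h1, h2⟩ := exists_agreeing (fun i => (b' i).2) he hg (hsize hN).1
        (hsize hN').1 x.2
      exact ⟨⟨y, hy⟩, step x ⟨y, hy⟩ h1 h2⟩
    · obtain ⟨x, hx, h1, h2⟩ := exists_agreeing (fun i => (b i).2) (fun i => (he i).symm)
        (fun i j => (hg i j).symm) (hsize hN').1 (hsize hN).1 y.2
      exact ⟨⟨x, hx⟩, step ⟨x, hx⟩ y h1.symm fun i => (h2 i).symm⟩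

/-- Lengthening a long strip does not change the state. -/
theorem exists_state_strip_eq {m : ℕ} {G : SimpleGraph (Fin n)} (k : ℕ) (hG : Admissible m G)
    (ht : HasTail m m G) (hn : m ≤ n) :
    ∃ N, state m k (strip m G N) = state m k (strip m G (N + 1)) := by
  obtain ⟨a, ha⟩ := hG.exists_isStubs
  -- The last summand is the length the game requires; `m + m * 2 ^ k` keeps the half-edges at the
  -- moving end beyond the threshold from the beginning and from those that stay.
  set N := n + m + m * 2 ^ k + (m * (m + 1) + k + 1) * (2 * (m * 2 ^ k) + 1) with hN
  refine ⟨N, state_eq_of_efType_eq (ha.strip ht hn N) (ha.strip ht hn (N + 1))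
    (efType_strip_eq G k _ _ (fun i => ?_) (fun i j => ?_) (by omega) (by omega))⟩
  · have := (a i).2
    simp only [EndsAgree, stripStubs]
    split_ifs <;> omega
  · have := (a i).2
    have := (a j).2
    simp only [GapsAgree, stripStubs]
    split_ifs <;> omega

end Game

/-! ### The maximum principle and the exclusion of periodicity -/

section Recurrence

open Classical

variable {m n k : ℕ}

/-- From any admissible graph the process can make the last `i ≤ m` vertices a tail. -/
theorem exists_hasTail {C : ∀ n, SimpleGraph (Fin n) → Prop} (hm : 0 < m)
    (hadm : ∀ n G, C n G → Admissible m G)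
    (hstep : ∀ n G, C n G → ∀ S ∈ (openVertices (2 * m) G).powersetCard m,
      C (n + 1) (addVertex G S))
    {G : SimpleGraph (Fin n)} (hG : C n G) {i : ℕ} (hi : i ≤ m) :
    ∃ H : SimpleGraph (Fin (n + i)), C (n + i) H ∧ HasTail m i H := by
  induction i with
  | zero => exact ⟨G, hG, fun v hv => absurd v.2 (by simp only [Nat.add_zero] at *; omega)⟩
  | succ i ih =>
    obtain ⟨H, hH, ht⟩ := ih (by omega)
    -- The present tail consists of at most `m` open vertices, so it extends to an allowed choice
    -- `S`.
    obtain ⟨S, h1, h2, h3⟩ := Finset.exists_subsuperset_card_eq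
      (ht.lastVertices_subset (by omega)) ((card_lastVertices_le i (n + i)).trans (by omega))
      ((hadm _ H hH).card_openVertices hm).le
    exact ⟨addVertex H S, hstep _ H hH S (Finset.mem_powersetCard.2 ⟨h2, h3⟩),
      ht.addVertex h1 h3⟩

/-- Maximum principle: the average over all steps already has the largest possible modulus, so all
the averaged values coincide with it. -/
theorem apply_state_addVertex_eq {μ : ℂ} (hμ : ‖μ‖ = 1)
    {h : Set (EFType k (m * (m + 1))) → ℂ} (hh : transition m k h = μ • h)
    {G : SimpleGraph (Fin n)} (hG : Admissible m G) (hmax : ‖h (state m k G)‖ = ‖h‖)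
    {S : Finset (Fin n)} (hS : S ∈ (openVertices (2 * m) G).powersetCard m) :
    h (state m k (addVertex G S)) = μ * h (state m k G) := by
  have h1 : stepMean m k G h = μ * h (state m k G) := by
    rw [← transition_apply_state hG, hh, Pi.smul_apply, smul_eq_mul]
  have hne : (((openVertices (2 * m) G).powersetCard m).card : ℂ) ≠ 0 := by
    rw [Nat.cast_ne_zero, Finset.card_ne_zero]
    exact ⟨S, hS⟩
  rw [stepMean, div_eq_iff hne, mul_comm _ (Nat.cast _)] at h1
  refine eq_of_sum_eq_card_mul _ (fun S => h (state m k (addVertex G S))) _ (fun T _ => ?_) h1 S hS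
  rw [norm_mul, hμ, one_mul, hmax]
  exact norm_le_pi_norm h _

theorem eq_one_of_transition_eq_smul (hm : 0 < m) {μ : ℂ} (hμ : ‖μ‖ = 1)
    {h : Set (EFType k (m * (m + 1))) → ℂ} (h0 : h ≠ 0) (hh : transition m k h = μ • h) :
    μ = 1 := by
  have eq_one : ∀ τ, ‖h τ‖ = ‖h‖ → h τ = μ * h τ → μ = 1 := by
    intro τ hτ h1
    have h2 : h τ ≠ 0 := by
      rw [← norm_ne_zero_iff, hτ, norm_ne_zero_iff]
      exact h0
    exact (mul_eq_right₀ h2).1 h1.symm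
  obtain ⟨τ, hτ⟩ : ∃ τ, ‖h τ‖ = ‖h‖ := by
    obtain ⟨τ, -, hτ⟩ := Finset.exists_max_image Finset.univ (fun τ => ‖h τ‖) ⟨∅, by simp⟩
    exact ⟨τ, (norm_le_pi_norm h τ).antisymm
      ((pi_norm_le_iff_of_nonneg (norm_nonneg _)).2 fun σ => hτ σ (Finset.mem_univ σ))⟩
  by_cases hX : ∃ X : Σ n, SimpleGraph (Fin n), Admissible m X.2 ∧ state m k X.2 = τ
  · obtain ⟨⟨n, G⟩, hG, rfl⟩ := hX
    -- The graphs at whose state `|h|` is maximal are closed under all steps of the process, so a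
    -- strip can be built inside this class.
    let C : ∀ n, SimpleGraph (Fin n) → Prop := fun n G =>
      Admissible m G ∧ ‖h (state m k G)‖ = ‖h‖
    have hstep : ∀ n G, C n G → ∀ S ∈ (openVertices (2 * m) G).powersetCard m,
        C (n + 1) (addVertex G S) := by
      intro n G hC S hS
      refine ⟨hC.1.addVertex hS, ?_⟩
      rw [apply_state_addVertex_eq hμ hh hC.1 hC.2 hS, norm_mul, hμ, one_mul, hC.2]
    obtain ⟨H, hH, ht⟩ := exists_hasTail hm (fun n G hC => hC.1) hstep (G := G) ⟨hG, hτ⟩ le_rfl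
    have hstrip : ∀ N, C (n + m + N) (strip m H N) := by
      intro N
      induction N with
      | zero => exact hH
      | succ N ih => exact hstep _ _ ih _ (ht.lastVertices_mem (by omega) N)
    obtain ⟨N, hN⟩ := exists_state_strip_eq k hH.1 ht (by omega)
    refine eq_one _ (hstrip N).2 ?_
    conv_lhs => rw [hN]
    exact apply_state_addVertex_eq hμ hh (hstrip N).1 (hstrip N).2
      (ht.lastVertices_mem (by omega) N)
  -- Off the states of admissible graphs the operator is the identity, so `h τ = μ * h τ` at once.
  · refine eq_one τ hτ ?_
    rw [← smul_eq_mul, ← Pi.smul_apply, ← hh, transition_apply_of_not_exists hX]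

theorem exists_tendsto_transition_pow (hm : 0 < m) (h : Set (EFType k (m * (m + 1))) → ℂ) :
    ∃ l, Filter.Tendsto (fun t => (transition m k ^ t) h) Filter.atTop (nhds l) :=
  exists_tendsto_pow_apply norm_transition_le
    (fun _ _ hμ h0 hh => eq_one_of_transition_eq_smul hm hμ h0 hh) h

end Recurrence

/-! ### From the transition operator to probabilities -/

section Expectation

open Classical

/-- The expectation of a complex-valued function on a finite probability space. -/
noncomputable def mean {α : Type*} [Fintype α] (p : PMF α) (f : α → ℂ) : ℂ :=
  ∑ x, ((p x).toReal : ℂ) * f x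

variable {α β : Type*} [Fintype α] [Fintype β]

theorem mean_congr {p : PMF α} {f g : α → ℂ} (h : ∀ x ∈ p.support, f x = g x) :
    mean p f = mean p g := by
  refine Finset.sum_congr rfl fun x _ => ?_
  by_cases hx : p x = 0
  · simp [hx]
  · rw [h x ((p.mem_support_iff x).2 hx)]

theorem mean_pure (x : α) (f : α → ℂ) : mean (PMF.pure x) f = f x := by
  rw [mean, Finset.sum_eq_single x] <;> simp +contextual [PMF.pure_apply]

theorem mean_bind (p : PMF α) (q : α → PMF β) (f : β → ℂ) :
    mean (p.bind q) f = mean p fun a => mean (q a) f := by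
  have h : ∀ b, (((p.bind q) b).toReal : ℂ) = ∑ a, ((p a).toReal : ℂ) * ((q a b).toReal : ℂ) := by
    intro b
    rw [PMF.bind_apply, tsum_fintype, ENNReal.toReal_sum fun a _ =>
      ENNReal.mul_ne_top (p.apply_ne_top a) ((q a).apply_ne_top b)]
    push_cast [ENNReal.toReal_mul]
    rfl
  simp only [mean, h, Finset.sum_mul, Finset.mul_sum]
  rw [Finset.sum_comm]
  simp only [mul_assoc]

theorem mean_map_uniformOfFinset (s : Finset α) (hs : s.Nonempty) (g : α → β) (f : β → ℂ) :
    mean ((PMF.uniformOfFinset s hs).map g) f = (∑ x ∈ s, f (g x)) / s.card := by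
  rw [PMF.map, mean_bind]
  simp only [Function.comp_apply, mean_pure]
  rw [mean, Finset.sum_div, ← Finset.sum_subset (Finset.subset_univ s)]
  · refine Finset.sum_congr rfl fun x hx => ?_
    rw [PMF.uniformOfFinset_apply_of_mem hs hx]
    simp [div_eq_inv_mul]
  · intro x _ hx
    rw [PMF.uniformOfFinset_apply_of_notMem hs hx]
    simp

theorem coe_toReal_toOuterMeasure (p : PMF α) (s : Set α) :
    ((p.toOuterMeasure s).toReal : ℂ) = mean p fun x => if x ∈ s then 1 else 0 := by
  rw [PMF.toOuterMeasure_apply_fintype, ENNReal.toReal_sum]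
  · rw [mean]
    push_cast
    refine Finset.sum_congr rfl fun x _ => ?_
    by_cases hx : x ∈ s <;> simp [hx]
  · intro x _
    by_cases hx : x ∈ s <;> simp [hx, p.apply_ne_top x]

variable {m k : ℕ}

theorem mean_step {n : ℕ} (hm : 0 < m) {G : SimpleGraph (Fin n)} (hG : Admissible m G)
    (h : Set (EFType k (m * (m + 1))) → ℂ) :
    mean (step m (2 * m) G) (fun H => h (state m k H)) = stepMean m k G h := by
  have hne : ((openVertices (2 * m) G).powersetCard m).Nonempty :=
    Finset.powersetCard_nonempty.2 (hG.card_openVertices hm).le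
  rw [step, dif_pos hne, mean_map_uniformOfFinset, stepMean]

/-- Conditioning on the graph before the last step turns `h` into `transition m k h`; admissibility
holds only on the support of the law, hence `mean_congr`. -/
theorem mean_law (hm : 0 < m) (t : ℕ) (h : Set (EFType k (m * (m + 1))) → ℂ) :
    mean (law m (2 * m) t) (fun G => h (state m k G)) =
      (transition m k ^ t) h (state m k (⊤ : SimpleGraph (Fin (m + 1 + 0)))) := by
  induction t generalizing h with
  | zero => simp only [law, mean_pure, pow_zero, Module.End.one_apply]
  | succ t ih =>
    rw [pow_succ, Module.End.mul_apply, ← ih]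
    refine (mean_bind _ _ _).trans (mean_congr fun G hG => ?_)
    have hG := admissible_of_mem_support hm t G hG
    rw [transition_apply_state hG]
    exact mean_step hm hG h

/-- The state determines the truth of a first-order sentence. -/
theorem exists_models_iff_of_state_eq (m : ℕ) (φ : Language.graph.Sentence) :
    ∃ k, ∀ {n n' : ℕ} {G : SimpleGraph (Fin n)} {G' : SimpleGraph (Fin n')}, Admissible m G →
      state m k G = state m k G' → (Models G φ ↔ Models G' φ) := by
  obtain ⟨k, hk⟩ := exists_efType_determines φ
  refine ⟨k, fun {n n' G G'} hG hs => ?_⟩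
  obtain ⟨a, ha⟩ := hG.exists_isStubs
  have : efType G k a ∈ state m k G' := hs ▸ ⟨a, ha, rfl⟩
  obtain ⟨a', ha', he⟩ := this
  refine hk _ _ G G' _ _ _ _ ?_
  -- A sentence concerns the empty tuple, so all entries of the list are forgotten.
  have := efType_comp k (Fin.elim0 : Fin 0 → Fin (m * (m + 1))) he.symm
  convert this

end Expectation

open Classical in
theorem exists_tendsto_prob {m : ℕ} (hm : 0 < m)
    (φ : Language.graph.Sentence) :
    ∃ p : ℝ, Filter.Tendsto (fun t => prob (law m (2 * m) t) φ) Filter.atTop (nhds p) := by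
  obtain ⟨k, hk⟩ := exists_models_iff_of_state_eq m φ
  -- By the choice of `k`, one model with a given state means that all admissible graphs with that
  -- state are models.
  let h : Set (EFType k (m * (m + 1))) → ℂ := fun τ =>
    if ∃ X : Σ n, SimpleGraph (Fin n), Admissible m X.2 ∧ state m k X.2 = τ ∧ Models X.2 φ
    then 1 else 0
  have h1 : ∀ t, (prob (law m (2 * m) t) φ : ℂ) =
      (transition m k ^ t) h (state m k (⊤ : SimpleGraph (Fin (m + 1 + 0)))) := by
    intro t
    rw [← mean_law hm, prob, coe_toReal_toOuterMeasure]
    refine mean_congr fun G hG => ?_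
    have hG := admissible_of_mem_support hm t G hG
    have : G ∈ {G | Models G φ} ↔ ∃ X : Σ n, SimpleGraph (Fin n),
        Admissible m X.2 ∧ state m k X.2 = state m k G ∧ Models X.2 φ :=
      ⟨fun hφ => ⟨⟨_, G⟩, hG, rfl, hφ⟩, fun ⟨X, hX, hs, hφ⟩ => (hk hX hs).1 hφ⟩
    simp only [this, h]
  obtain ⟨l, hl⟩ := exists_tendsto_transition_pow hm h
  have h2 := (Complex.continuous_re.tendsto _).comp
    (tendsto_pi_nhds.1 hl (state m k (⊤ : SimpleGraph (Fin (m + 1 + 0)))))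
  refine ⟨_, h2.congr fun t => ?_⟩
  rw [Function.comp_apply, ← h1, Complex.ofReal_re]

end UniformAttachment

theorem theorem2 (m d : ℕ) (hm : 1 < m) (hd : d = 2 * m) :
    UniformAttachment.FOConvergenceLaw (UniformAttachment.law m d) := by
  subst hd
  exact fun φ => UniformAttachment.exists_tendsto_prob (by omega) φ
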